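/- \textbf{Theorem (SDP-stability of matrix-weighted localization).} Let $\mathcal E\subset[N_p]\times[N_m]$ be a finite set of pose--landmark edges, let $p_k\in\mathbb R^3$ ($k\in[N_m]$) be known landmark positions, and let $W_{ik}\in\mathbb R^{3\times3}$, $(i,k)\in\mathcal E$, be symmetric positive definite weights. Assume that for every pose $i\in[N_p]$ the observed landmarks $\{p_k:(i,k)\in\mathcal E\}$ do not lie in a common plane. Given measurements $\tilde m=(\tilde m_{ik})_{(i,k)\in\mathcal E}$, $\tilde m_{ik}\in\mathbb R^3$, consider the matrix-weighted localization problem $$\min_{C_i\in\mathbb R^{3\times 3},\,t_i\in\mathbb R^3}\ \sum_{(i,k)\in\mathcal E} e_{ik}^T W_{ik}e_{ik},\qquad e_{ik}=\tilde m_{ik}-C_ip_k+t_i,\qquad (\mathrm{Loc})$$ $$\text{s.t. } C_i^TC_i=I,\quad c_i^1\times c_i^2-c_i^3=0\quad (i\in[N_p]),$$ where $c_i^j$ is the $j$-th column of $C_i$ (so $C_i\in\mathrm{SO}(3)$). With $z=(\mathrm{vec}\,C_1,t_1,\dots,\mathrm{vec}\,C_{N_p},t_{N_p},w)$, write (Loc)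 in the homogeneous form $$\min_z\{z^TQz : z^TA_jz=0\ \forall j,\ z^TA_0z=1\},$$ where the symmetric matrices are given by $z^TQz=\sum_{(i,k)\in\mathcal E}\|w\tilde m_{ik}-C_ip_k+t_i\|_{W_{ik}}^2$ (with $\|v\|_W^2=v^TWv$), $z^TA_0z=w^2$, and the $A_j$ are those of the entries of $C_i^TC_i-w^2I$ and of $c_i^1\times c_i^2-wc_i^3$. Its SDP relaxation is $\min\{\langle Q,Z\rangle:\langle A_j,Z\rangle=0\ \forall j,\ \langle A_0,Z\rangle=1,\ Z\succeq0\}$ and its Lagrangian dual is $\max_{\lambda,\rho}\{-\rho: Q+\rho A_0+\sum_j\lambda_jA_j\succeq0\}$. For feasible poses $\bar x=(\bar C_i,\bar t_i)_i$ let $\bar m(\bar x)=(\bar C_ip_k-\bar t_i)_{(i,k)\in\mathcal E}$ be the associated noise-free measurements. Then there is $\epsilon>0$, depending only on $\mathcal E$, the landmarks $p_k$ and the weights $W_{ik}$, such that for all feasible poses $\bar x$ (in particular for a globally optimal solution of (Loc)) and all measurements $\tilde m$ with $\|\tilde m-\bar m(\bar x)\|^2<\epsilon$ (Euclidean norm of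 the stacked vector) the following hold for the problem with data $\tilde m$: \begin{enumerate} \item the SDP relaxation is tight: the homogeneous problem and its relaxation attain their minima, the two minimum values are equal, and the minimizers of the relaxation are exactly the matrices $zz^T$ with $z$ a minimizer of the homogeneous problem; \item strong duality holds: the dual maximum is attained and equals the minimum of the homogeneous problem; \item (Loc) has a unique global minimizer and the SDP relaxation has a unique minimizer $Z^*$; \item the global minimizer can be recovered from $Z^*$: $Z^*$ has rank one, the $C_i$ and $t_i$ read off from the column of $Z^*$ indexed by $w$ form the global minimizer of (Loc), and its cost equals $\langle Q,Z^*\rangle$. \end{enumerate} -/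

import Mathlib

open scoped Matrix

noncomputable section

/-- A homogeneous quadratically constrained quadratic program in standard form:
minimize `zᵀ Q z` subject to `zᵀ A i z = 0` for all `i` and `zᵀ A₀ z = 1`. -/
structure QCQP (n ι : Type) where
  Q : Matrix n n ℝ
  A₀ : Matrix n n ℝ
  A : ι → Matrix n n ℝ

namespace QCQP

variable {n ι : Type} [Fintype n] [Fintype ι]

/-- The Frobenius inner product of two real matrices. -/
def frob (M N : Matrix n n ℝ) : ℝ := (Mᵀ * N).trace

/-- The objective `zᵀ Q z`. -/
def cost (P : QCQP n ι) (z : n → ℝ) : ℝ := z ⬝ᵥ (P.Q *ᵥ z)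

/-- The feasible set of the QCQP. -/
def feasible (P : QCQP n ι) : Set (n → ℝ) :=
  {z | (∀ i, z ⬝ᵥ (P.A i *ᵥ z) = 0) ∧ z ⬝ᵥ (P.A₀ *ᵥ z) = 1}

/-- `z` is a global minimizer of the QCQP. -/
def IsSolution (P : QCQP n ι) (z : n → ℝ) : Prop :=
  z ∈ P.feasible ∧ IsMinOn P.cost P.feasible z

/-- The objective `⟨Q, Z⟩` of the semidefinite relaxation. -/
def sdpCost (P : QCQP n ι) (Z : Matrix n n ℝ) : ℝ := frob P.Q Z

/-- The feasible set of the semidefinite relaxation (the rank constraint is dropped). -/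
def sdpFeasible (P : QCQP n ι) : Set (Matrix n n ℝ) :=
  {Z | (∀ i, frob (P.A i) Z = 0) ∧ frob P.A₀ Z = 1 ∧ Z.PosSemidef}

/-- `Z` is a global minimizer of the semidefinite relaxation. -/
def IsSDPSolution (P : QCQP n ι) (Z : Matrix n n ℝ) : Prop :=
  Z ∈ P.sdpFeasible ∧ IsMinOn P.sdpCost P.sdpFeasible Z

/-- The dual matrix `H(lam, rho) = Q + rho A₀ + ∑ i, lam i A i`. -/
def dualMatrix (P : QCQP n ι) (lam : ι → ℝ) (rho : ℝ) : Matrix n n ℝ :=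
  P.Q + rho • P.A₀ + ∑ i, lam i • P.A i

/-- The feasible set of the Lagrangian dual. -/
def dualFeasible (P : QCQP n ι) : Set ((ι → ℝ) × ℝ) :=
  {d | (P.dualMatrix d.1 d.2).PosSemidef}

/-- The objective `-rho` of the Lagrangian dual. -/
def dualCost (d : (ι → ℝ) × ℝ) : ℝ := -d.2

/-- `d = (lam, rho)` is a global maximizer of the Lagrangian dual. -/
def IsDualSolution (P : QCQP n ι) (d : (ι → ℝ) × ℝ) : Prop :=
  d ∈ P.dualFeasible ∧ IsMaxOn dualCost P.dualFeasible d

/-- The semidefinite relaxation is tight: both problems attain their minima, they have the same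
optimal cost, and their minimizers are equivalent (correspond under `Z = z zᵀ`). -/
def IsTight (P : QCQP n ι) : Prop :=
  (∃ z, P.IsSolution z) ∧
  (∀ z Z, P.IsSolution z → P.IsSDPSolution Z → P.sdpCost Z = P.cost z) ∧
  (∀ Z, P.IsSDPSolution Z ↔ ∃ z, P.IsSolution z ∧ Z = Matrix.vecMulVec z z)

/-- Strong duality: the QCQP and its Lagrangian dual attain their optima, with equal values. -/
def StrongDuality (P : QCQP n ι) : Prop :=
  ∃ z d, P.IsSolution z ∧ P.IsDualSolution d ∧ P.cost z = dualCost d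

end QCQP

/-- The fixed data of a matrix-weighted localization problem with `Np` poses and `Nm` known
landmarks: the pose-landmark edges, the landmark positions (world frame) and the weights. -/
structure PoseLocalization (Np Nm : ℕ) where
  edges : Finset (Fin Np × Fin Nm)
  landmark : Fin Nm → Fin 3 → ℝ
  weight : edges → Matrix (Fin 3) (Fin 3) ℝ

/-- A candidate pose for each index: the matrices `C i` and the vectors `t i`. -/
abbrev Poses (Np : ℕ) : Type := Fin Np → Matrix (Fin 3) (Fin 3) ℝ × (Fin 3 → ℝ)

namespace PoseLocalization

variable {Np Nm : ℕ} (P : PoseLocalization Np Nm)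

/-- All pose-landmark measurements stacked in one vector, with its Euclidean norm. -/
abbrev Measurements : Type := EuclideanSpace ℝ (P.edges × Fin 3)

/-- The constraints `Cᵀ C = I`, `c¹ × c² - c³ = 0` on every pose; that is, `C ∈ SO(3)`. -/
def feasible : Set (Poses Np) :=
  {x | ∀ i, (x i).1ᵀ * (x i).1 = 1 ∧
    crossProduct ((x i).1.col 0) ((x i).1.col 1) - (x i).1.col 2 = 0}

/-- The noise-free measurements `C i p_k - t i` of the landmarks `p_k` from the poses `x`. -/
def noiseFree (x : Poses Np) : P.Measurements :=
  WithLp.toLp 2 fun er =>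
    ((x er.1.1.1).1 *ᵥ P.landmark er.1.1.2 - (x er.1.1.1).2) er.2

/-- The error term `e_ik = m_ik - C i p_k + t i` of an edge. -/
def err (m : P.Measurements) (x : Poses Np) (e : P.edges) : Fin 3 → ℝ :=
  (fun r => m (e, r)) - (x e.1.1).1 *ᵥ P.landmark e.1.2 + (x e.1.1).2

/-- The weighted least-squares cost. -/
def cost (m : P.Measurements) (x : Poses Np) : ℝ :=
  ∑ e : P.edges, P.err m x e ⬝ᵥ (P.weight e *ᵥ P.err m x e)

/-- `x` is a global minimizer of the localization problem with measurements `m`. -/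
def IsSolution (m : P.Measurements) (x : Poses Np) : Prop :=
  x ∈ feasible (Np := Np) ∧ IsMinOn (P.cost m) feasible x

/-! ### The standard-form QCQP, in the variable `z = (vec (C i), t i, w)` -/

/-- Indices of the coordinates of `z`. -/
abbrev Idx (Np : ℕ) : Type := (Fin Np × ((Fin 3 × Fin 3) ⊕ Fin 3)) ⊕ Unit

/-- The coordinate of the entry of `C i` in row `r` and column `c`. -/
def idxC (i : Fin Np) (r c : Fin 3) : Idx Np := Sum.inl (i, Sum.inl (r, c))

/-- The coordinate of the entry `r` of `t i`. -/
def idxT (i : Fin Np) (r : Fin 3) : Idx Np := Sum.inl (i, Sum.inr r)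

/-- The homogenizing coordinate `w`. -/
def idxW : Idx Np := Sum.inr ()

/-- The symmetric matrix whose quadratic form is `z ↦ z a * z b`. -/
def mono (a b : Idx Np) : Matrix (Idx Np) (Idx Np) ℝ :=
  (1 / 2 : ℝ) • (Matrix.single a b 1 + Matrix.single b a 1)

/-- The matrix of the linear map `z ↦ w m_ik - C i p_k + t i`. -/
def errMatrix (m : P.Measurements) (e : P.edges) : Matrix (Fin 3) (Idx Np) ℝ :=
  Matrix.of fun r j => match j with
    | Sum.inl (i, Sum.inl (r', c)) => if i = e.1.1 ∧ r' = r then -P.landmark e.1.2 c else 0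
    | Sum.inl (i, Sum.inr r') => if i = e.1.1 ∧ r' = r then 1 else 0
    | Sum.inr _ => m (e, r)

/-- The quadratic cost matrix. -/
def costMatrix (m : P.Measurements) : Matrix (Idx Np) (Idx Np) ℝ :=
  ∑ e : P.edges, (P.errMatrix m e)ᵀ * P.weight e * P.errMatrix m e

/-- Entry `(a, b)` of the homogenized constraint `(C i)ᵀ C i - w² I = 0`. -/
def orthMatrix (i : Fin Np) (a b : Fin 3) : Matrix (Idx Np) (Idx Np) ℝ :=
  ∑ r, mono (idxC i r a) (idxC i r b) - if a = b then mono idxW idxW else 0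

/-- Entry `r` of the homogenized constraint `c¹ × c² - w c³ = 0`; indices are modulo `3`. -/
def crossMatrix (i : Fin Np) (r : Fin 3) : Matrix (Idx Np) (Idx Np) ℝ :=
  mono (idxC i (r + 1) 0) (idxC i (r + 2) 1) - mono (idxC i (r + 2) 0) (idxC i (r + 1) 1)
    - mono idxW (idxC i r 2)

/-- The localization problem as a QCQP in standard form, with homogenizing constraint `w² = 1`. -/
def toQCQP (m : P.Measurements) : QCQP (Idx Np) (Fin Np × ((Fin 3 × Fin 3) ⊕ Fin 3)) where
  Q := P.costMatrix m
  A₀ := mono idxW idxW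
  A := fun j => match j with
    | (i, Sum.inl (a, b)) => orthMatrix i a b
    | (i, Sum.inr r) => crossMatrix i r

/-- The poses read off from the `w`-column of a lifted matrix `Z`. -/
def recover (Z : Matrix (Idx Np) (Idx Np) ℝ) : Poses Np :=
  fun i => (Matrix.of fun r c => Z (idxC i r c) idxW, fun r => Z (idxT i r) idxW)

end PoseLocalization

end

/-!
The Lagrangian multipliers of a global minimizer can be written down, and the dual matrix they
define can be bounded from below directly.

Let `x = (C i, t i)` be a minimizer for the measurements `m`, with residual `u`, and let
`G i = ∑ Wₑ uₑ pₑᵀ` be the moment of the residual over the edges of the pose `i`. Optimality in the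
translations and along Cayley curves in the rotation group gives that the matrices `(C i)ᵀ G i` are
symmetric (`isSymm_transpose_mul_moment`). They serve as multipliers of the orthonormality
constraints; the cross product constraints get multiplier zero. For `z = (w x + y, w)` the
quadratic form of the dual matrix then reduces to

  `‖N y‖²_W + ∑ i, tr ((C i)ᵀ G i (D i)ᵀ D i)`,

where `N` is the linear map from poses to noise-free measurements and `D i` are the matrix parts of
`y` (`dotProduct_dualMatrix_multipliers`).

As the landmarks seen from each pose are not coplanar, `N` is injective, so `‖N y‖²_W ≥ δ ‖y‖²` with
`δ > 0` depending on the edges, landmarks and weights alone (`exists_pos_mul_sqNorm_le`). The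
second term is at most a constant times `‖u‖ ‖y‖²`, and `‖u‖` is controlled by the noise, because
the cost of `x` is at most that of `xbar`. So for small noise the dual matrix is positive
semidefinite with kernel spanned by `(x, 1)` (`exists_isStrictCertificate`). Complementary slackness
turns such a certificate into tightness, strong duality and uniqueness (the lemmas on
`QCQP.IsStrictCertificate`).
-/

noncomputable section

/-! ### Strict dual certificates for quadratically constrained programs -/

namespace QCQP

variable {n ι : Type} [Fintype n]

theorem frob_vecMulVec (M : Matrix n n ℝ) (v : n → ℝ) :
    frob M (Matrix.vecMulVec v v) = v ⬝ᵥ (M *ᵥ v) := by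
  rw [frob, Matrix.mul_vecMulVec, Matrix.trace_vecMulVec, Matrix.mulVec_transpose,
    Matrix.dotProduct_mulVec]

theorem frob_sum_right {κ : Type} (s : Finset κ) (M : Matrix n n ℝ) (N : κ → Matrix n n ℝ) :
    frob M (∑ k ∈ s, N k) = ∑ k ∈ s, frob M (N k) := by
  simp [frob, Finset.mul_sum, Matrix.trace_sum]

theorem sdpFeasible_vecMulVec {P : QCQP n ι} {z : n → ℝ} (hz : z ∈ P.feasible) :
    Matrix.vecMulVec z z ∈ P.sdpFeasible := by
  refine ⟨fun i => ?_, ?_, ?_⟩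
  · rw [frob_vecMulVec]; exact hz.1 i
  · rw [frob_vecMulVec]; exact hz.2
  · simpa using Matrix.posSemidef_vecMulVec_self_star z

variable [Fintype ι]

theorem frob_dualMatrix (P : QCQP n ι) (lam : ι → ℝ) (rho : ℝ) (Z : Matrix n n ℝ) :
    frob (P.dualMatrix lam rho) Z =
      P.sdpCost Z + rho * frob P.A₀ Z + ∑ i, lam i * frob (P.A i) Z := by
  simp [frob, dualMatrix, sdpCost, Matrix.add_mul, Matrix.transpose_sum, Finset.sum_mul,
    Matrix.trace_sum]

/-- On the feasible set of the relaxation the Lagrangian is the objective shifted by `rho`. -/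
theorem frob_dualMatrix_of_sdpFeasible {P : QCQP n ι} (lam : ι → ℝ) (rho : ℝ)
    {Z : Matrix n n ℝ} (hZ : Z ∈ P.sdpFeasible) :
    frob (P.dualMatrix lam rho) Z = P.sdpCost Z + rho := by
  rw [frob_dualMatrix, hZ.2.1]
  simp [hZ.1]

theorem dotProduct_dualMatrix_mulVec (P : QCQP n ι) (lam : ι → ℝ) (rho : ℝ) (z : n → ℝ) :
    z ⬝ᵥ (P.dualMatrix lam rho *ᵥ z) =
      P.cost z + rho * (z ⬝ᵥ (P.A₀ *ᵥ z)) + ∑ i, lam i * (z ⬝ᵥ (P.A i *ᵥ z)) := by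
  simp only [← frob_vecMulVec, frob_dualMatrix, sdpCost, cost]

theorem dotProduct_dualMatrix_of_feasible {P : QCQP n ι} (lam : ι → ℝ) (rho : ℝ)
    {z : n → ℝ} (hz : z ∈ P.feasible) :
    z ⬝ᵥ (P.dualMatrix lam rho *ᵥ z) = P.cost z + rho := by
  rw [dotProduct_dualMatrix_mulVec, hz.2]
  simp [hz.1]

/-- A strict dual certificate for the point `z`: a dual feasible `d` whose dual matrix has its
kernel spanned by the feasible point `z`. For a positive semidefinite matrix the kernel is the
zero set of the quadratic form, which is how it is expressed here. -/
structure IsStrictCertificate (P : QCQP n ι) (z : n → ℝ) (d : (ι → ℝ) × ℝ) : Prop where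
  feasible : z ∈ P.feasible
  posSemidef : (P.dualMatrix d.1 d.2).PosSemidef
  isotropic : z ⬝ᵥ (P.dualMatrix d.1 d.2 *ᵥ z) = 0
  eq_smul : ∀ v, v ⬝ᵥ (P.dualMatrix d.1 d.2 *ᵥ v) = 0 → ∃ c : ℝ, v = c • z

/-- Complementary slackness: a positive semidefinite `Z` that is Frobenius-orthogonal to a positive
semidefinite `H` with kernel spanned by `z` is a nonnegative multiple of `z zᵀ`. -/
theorem eq_smul_vecMulVec_of_frob_eq_zero {H Z : Matrix n n ℝ} {z : n → ℝ}
    (hH : H.PosSemidef) (hker : ∀ v, v ⬝ᵥ (H *ᵥ v) = 0 → ∃ c : ℝ, v = c • z)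
    (hZ : Z.PosSemidef) (h0 : frob H Z = 0) : ∃ c : ℝ, Z = c • Matrix.vecMulVec z z := by
  obtain ⟨m, v, rfl⟩ := Matrix.posSemidef_iff_eq_sum_vecMulVec.1 hZ
  simp only [star_trivial] at *
  rw [frob_sum_right, Finset.sum_eq_zero_iff_of_nonneg] at h0
  · have h1 : ∀ i, ∃ c : ℝ, v i = c • z := fun i =>
      hker _ (by rw [← frob_vecMulVec]; exact h0 i (Finset.mem_univ _))
    choose c hc using h1
    refine ⟨∑ i, c i * c i, ?_⟩
    rw [Finset.sum_smul]
    refine Finset.sum_congr rfl fun i _ => ?_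
    rw [hc i, Matrix.smul_vecMulVec, Matrix.vecMulVec_smul, smul_smul]
  · intro i _
    rw [frob_vecMulVec]
    simpa using hH.dotProduct_mulVec_nonneg (v i)

theorem frob_nonneg {H Z : Matrix n n ℝ} (hH : H.PosSemidef) (hZ : Z.PosSemidef) :
    0 ≤ frob H Z := by
  obtain ⟨m, v, rfl⟩ := Matrix.posSemidef_iff_eq_sum_vecMulVec.1 hZ
  rw [frob_sum_right]
  refine Finset.sum_nonneg fun i _ => ?_
  rw [star_trivial, frob_vecMulVec]
  simpa using hH.dotProduct_mulVec_nonneg (v i)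

namespace IsStrictCertificate

variable {P : QCQP n ι} {z : n → ℝ} {d : (ι → ℝ) × ℝ}

theorem cost_eq (h : P.IsStrictCertificate z d) : P.cost z = -d.2 := by
  have := dotProduct_dualMatrix_of_feasible d.1 d.2 h.feasible
  rw [h.isotropic] at this
  linarith

theorem isSolution (h : P.IsStrictCertificate z d) : P.IsSolution z := by
  refine ⟨h.feasible, fun v hv => ?_⟩
  have h1 := dotProduct_dualMatrix_of_feasible d.1 d.2 hv
  have h2 := h.posSemidef.dotProduct_mulVec_nonneg v
  rw [star_trivial, h1] at h2
  simp only [Set.mem_ofPred_eq]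
  rw [h.cost_eq]
  linarith

theorem isDualSolution (h : P.IsStrictCertificate z d) : P.IsDualSolution d := by
  refine ⟨h.posSemidef, fun d' hd' => ?_⟩
  have h1 := dotProduct_dualMatrix_of_feasible d'.1 d'.2 h.feasible
  have h2 := Matrix.PosSemidef.dotProduct_mulVec_nonneg hd' z
  rw [star_trivial, h1, h.cost_eq] at h2
  simp only [Set.mem_ofPred_eq, dualCost]
  linarith

/-- The minimizers of the program are `z` and `-z`. -/
theorem eq_or_eq_neg (h : P.IsStrictCertificate z d) {v : n → ℝ} (hv : P.IsSolution v) :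
    v = z ∨ v = -z := by
  have h1 : P.cost v = P.cost z := le_antisymm (hv.2 h.feasible) (h.isSolution.2 hv.1)
  have h2 := dotProduct_dualMatrix_of_feasible d.1 d.2 hv.1
  rw [h1, h.cost_eq, neg_add_cancel] at h2
  obtain ⟨c, rfl⟩ := h.eq_smul v h2
  have h3 := hv.1.2
  rw [Matrix.mulVec_smul, dotProduct_smul, smul_dotProduct, h.feasible.2] at h3
  simp only [smul_eq_mul, mul_one] at h3
  rcases mul_self_eq_one_iff.1 h3 with rfl | rfl <;> simp

theorem isSDPSolution_iff (h : P.IsStrictCertificate z d) {Z : Matrix n n ℝ} :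
    P.IsSDPSolution Z ↔ Z = Matrix.vecMulVec z z := by
  have hz := sdpFeasible_vecMulVec h.feasible
  have hcost : P.sdpCost (Matrix.vecMulVec z z) = -d.2 := by
    rw [sdpCost, frob_vecMulVec]; exact h.cost_eq
  have hle : ∀ Y ∈ P.sdpFeasible, -d.2 ≤ P.sdpCost Y := fun Y hY => by
    have h1 := frob_nonneg h.posSemidef hY.2.2
    rw [frob_dualMatrix_of_sdpFeasible d.1 d.2 hY] at h1
    linarith
  constructor
  · intro hZ
    have h1 : P.sdpCost Z = -d.2 :=
      le_antisymm (hcost ▸ hZ.2 hz) (hle Z hZ.1)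
    have h2 := frob_dualMatrix_of_sdpFeasible d.1 d.2 hZ.1
    rw [h1, neg_add_cancel] at h2
    obtain ⟨c, rfl⟩ := eq_smul_vecMulVec_of_frob_eq_zero h.posSemidef h.eq_smul hZ.1.2.2 h2
    have h3 := hZ.1.2.1
    have h4 : frob P.A₀ (c • Matrix.vecMulVec z z) = c * frob P.A₀ (Matrix.vecMulVec z z) := by
      simp [frob]
    rw [h4, hz.2.1, mul_one] at h3
    rw [h3, one_smul]
  · rintro rfl
    refine ⟨hz, fun Y hY => ?_⟩
    simp only [Set.mem_ofPred_eq]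
    rw [hcost]
    exact hle Y hY

theorem isTight (h : P.IsStrictCertificate z d) : P.IsTight := by
  refine ⟨⟨z, h.isSolution⟩, fun v Z hv hZ => ?_, fun Z => ?_⟩
  · rw [h.isSDPSolution_iff.1 hZ, sdpCost, frob_vecMulVec]
    exact le_antisymm (h.isSolution.2 hv.1) (hv.2 h.feasible)
  · rw [h.isSDPSolution_iff]
    refine ⟨fun hZ => ⟨z, h.isSolution, hZ⟩, ?_⟩
    rintro ⟨v, hv, rfl⟩
    rcases h.eq_or_eq_neg hv with rfl | rfl
    · rfl
    · rw [Matrix.neg_vecMulVec, Matrix.vecMulVec_neg, neg_neg]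

theorem strongDuality (h : P.IsStrictCertificate z d) : P.StrongDuality :=
  ⟨z, d, h.isSolution, h.isDualSolution, h.cost_eq⟩

end IsStrictCertificate

end QCQP

/-! ### Definite quadratic forms and coplanarity -/

/-- On a finite-dimensional space, a continuous function that is homogeneous of degree two and
positive away from the origin dominates a positive multiple of the squared norm. -/
theorem exists_pos_mul_norm_sq_le {E : Type*} [NormedAddCommGroup E] [NormedSpace ℝ E]
    [FiniteDimensional ℝ E] (q : E → ℝ) (hq : Continuous q)
    (hsmul : ∀ (c : ℝ) v, q (c • v) = c ^ 2 * q v) (hpos : ∀ v, v ≠ 0 → 0 < q v) :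
    ∃ δ : ℝ, 0 < δ ∧ ∀ v, δ * ‖v‖ ^ 2 ≤ q v := by
  have hq0 : q 0 = 0 := by simpa using hsmul 0 0
  have : ProperSpace E := FiniteDimensional.proper ℝ E
  rcases (Metric.sphere (0 : E) 1).eq_empty_or_nonempty with hS | hS
  · refine ⟨1, one_pos, fun v => ?_⟩
    have hv : v = 0 := by
      by_contra hv
      have : ‖v‖⁻¹ • v ∈ Metric.sphere (0 : E) 1 := by
        simp [norm_smul, inv_mul_cancel₀ (norm_ne_zero_iff.2 hv)]
      simp [hS] at this
    simp [hv, hq0]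
  · obtain ⟨u, hu, hmin⟩ := (isCompact_sphere (0 : E) 1).exists_isMinOn hS hq.continuousOn
    refine ⟨q u, hpos u (ne_zero_of_mem_unit_sphere ⟨u, hu⟩), fun v => ?_⟩
    by_cases hv : v = 0
    · simp [hv, hq0]
    · have hn : ‖v‖ ≠ 0 := norm_ne_zero_iff.2 hv
      have h1 : ‖v‖⁻¹ • v ∈ Metric.sphere (0 : E) 1 := by
        simp [norm_smul, inv_mul_cancel₀ hn]
      have h2 : q u ≤ ‖v‖⁻¹ ^ 2 * q v := hsmul ‖v‖⁻¹ v ▸ hmin h1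
      calc q u * ‖v‖ ^ 2 ≤ ‖v‖⁻¹ ^ 2 * q v * ‖v‖ ^ 2 := by gcongr
        _ = q v := by field_simp

theorem coplanar_of_dotProduct_eq {S : Set (Fin 3 → ℝ)} {u : Fin 3 → ℝ} (hu : u ≠ 0) (c : ℝ)
    (h : ∀ p ∈ S, u ⬝ᵥ p = c) : Coplanar ℝ S := by
  let φ : (Fin 3 → ℝ) →ₗ[ℝ] ℝ := dotProductBilin ℝ ℝ u
  have hφ : ∀ v, φ v = u ⬝ᵥ v := fun v => rfl
  have hle : vectorSpan ℝ S ≤ LinearMap.ker φ := by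
    refine Submodule.span_le.2 ?_
    rintro _ ⟨p, hp, q, hq, rfl⟩
    simp [hφ, dotProduct_sub, h p hp, h q hq]
  have hker : LinearMap.ker φ ≠ ⊤ := fun htop => by
    have h1 : u ∈ LinearMap.ker φ := htop ▸ Submodule.mem_top
    rw [LinearMap.mem_ker, hφ] at h1
    exact hu (dotProduct_self_eq_zero.1 h1)
  have hlt := Submodule.finrank_lt hker
  rw [Module.finrank_fin_fun] at hlt
  have h2 := (Submodule.finrank_mono hle).trans (Nat.lt_succ_iff.1 hlt)
  rw [Coplanar, ← Module.finrank_eq_rank]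
  exact_mod_cast h2

/-! ### Rotation matrices -/

/-- In the presence of orthonormality, the cross product constraint says that the determinant
is one. -/
theorem crossProduct_col_eq_iff_det_eq_one {C : Matrix (Fin 3) (Fin 3) ℝ} (hC : Cᵀ * C = 1) :
    crossProduct (C.col 0) (C.col 1) - C.col 2 = 0 ↔ C.det = 1 := by
  constructor
  · intro h
    have h0 := congrFun h 0
    have h1 := congrFun h 1
    have h2 := congrFun h 2
    have h3 := congrFun (congrFun hC 2) 2
    simp [cross_apply, Matrix.mul_apply, Fin.sum_univ_three] at h0 h1 h2 h3
    rw [Matrix.det_fin_three]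
    linear_combination C 0 2 * h0 + C 1 2 * h1 + C 2 2 * h2 + h3
  · intro h
    have hadj : C.adjugate = Cᵀ := by
      have h1 := C.mul_adjugate
      rw [h, one_smul] at h1
      calc C.adjugate = Cᵀ * C * C.adjugate := by rw [hC, Matrix.one_mul]
        _ = Cᵀ := by rw [Matrix.mul_assoc, h1, Matrix.mul_one]
    rw [Matrix.adjugate_fin_three] at hadj
    have h0 := congrFun (congrFun hadj 2) 0
    have h1 := congrFun (congrFun hadj 2) 1
    have h2 := congrFun (congrFun hadj 2) 2
    simp at h0 h1 h2
    ext r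
    fin_cases r <;> simp [cross_apply] <;> linarith

theorem abs_entry_le_one_of_transpose_mul_self {C : Matrix (Fin 3) (Fin 3) ℝ} (hC : Cᵀ * C = 1)
    (r c : Fin 3) : |C r c| ≤ 1 := by
  have h := congrFun (congrFun hC c) c
  rw [Matrix.mul_apply, Matrix.one_apply_eq] at h
  have h1 : C r c * C r c ≤ 1 := by
    rw [← h]
    exact Finset.single_le_sum (f := fun j => Cᵀ c j * C j c)
      (fun j _ => mul_self_nonneg (C j c)) (Finset.mem_univ r)
  exact abs_le_one_iff_mul_self_le_one.2 h1

/-- The skew-symmetric matrix of the map `v ↦ a × v`. -/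
def skew (a : Fin 3 → ℝ) : Matrix (Fin 3) (Fin 3) ℝ :=
  !![0, -a 2, a 1; a 2, 0, -a 0; -a 1, a 0, 0]

theorem skew_smul (τ : ℝ) (a : Fin 3 → ℝ) : skew (τ • a) = τ • skew a := by
  ext i j
  fin_cases i <;> fin_cases j <;> simp [skew]

theorem skew_neg (a : Fin 3 → ℝ) : skew (-a) = -skew a := by
  simpa using skew_smul (-1) a

/-- The Cayley transform `(1 - Ω)⁻¹ (1 + Ω)` of `Ω = skew a`, written without the inverse by means
of `Ω³ = -‖a‖² Ω`. -/
def cayley (a : Fin 3 → ℝ) : Matrix (Fin 3) (Fin 3) ℝ :=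
  1 + (2 / (1 + a ⬝ᵥ a)) • (skew a + skew a * skew a)

theorem cayley_transpose_mul_self (a : Fin 3 → ℝ) : (cayley a)ᵀ * cayley a = 1 := by
  have h : (1 + (a 0 * a 0 + a 1 * a 1 + a 2 * a 2)) ≠ 0 :=
    (add_pos_of_pos_of_nonneg one_pos (by simp only [← sq]; positivity)).ne'
  ext i j
  fin_cases i <;> fin_cases j <;>
    simp [cayley, skew, Matrix.mul_apply, Fin.sum_univ_three, dotProduct] <;>
    field_simp <;> ring

theorem det_cayley (a : Fin 3 → ℝ) : (cayley a).det = 1 := by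
  have h : (1 + (a 0 * a 0 + a 1 * a 1 + a 2 * a 2)) ≠ 0 :=
    (add_pos_of_pos_of_nonneg one_pos (by simp only [← sq]; positivity)).ne'
  rw [Matrix.det_fin_three]
  simp [cayley, skew, Fin.sum_univ_three, dotProduct]
  field_simp
  ring

theorem isSymm_of_trace_mul_skew_eq_zero {M : Matrix (Fin 3) (Fin 3) ℝ}
    (h : ∀ a, (M * skew a).trace = 0) : M.IsSymm := by
  have h0 := h ![1, 0, 0]
  have h1 := h ![0, 1, 0]
  have h2 := h ![0, 0, 1]
  simp [skew, Matrix.trace, Matrix.mul_apply, Fin.sum_univ_three] at h0 h1 h2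
  ext i j
  fin_cases i <;> fin_cases j <;> simp <;> linarith

/-- A bound on the Frobenius pairing of `L` with the Gram matrix `Dᵀ D`. -/
theorem neg_mul_sum_sq_le_sum_mul_gram {L D : Matrix (Fin 3) (Fin 3) ℝ} {κ : ℝ}
    (hL : ∀ a b, |L a b| ≤ κ) :
    -(3 * κ) * ∑ r, ∑ c, D r c ^ 2 ≤ ∑ a, ∑ b, L a b * (Dᵀ * D) a b := by
  have key : ∀ a b r, -κ * ((D r a ^ 2 + D r b ^ 2) / 2) ≤ L a b * (D r a * D r b) := by
    intro a b r
    have hκ : 0 ≤ κ := (abs_nonneg _).trans (hL a b)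
    have h1 : |D r a * D r b| ≤ (D r a ^ 2 + D r b ^ 2) / 2 := by
      rw [abs_le]
      constructor <;> nlinarith [sq_nonneg (D r a + D r b), sq_nonneg (D r a - D r b)]
    have h2 : |L a b * (D r a * D r b)| ≤ κ * ((D r a ^ 2 + D r b ^ 2) / 2) := by
      rw [abs_mul]
      exact mul_le_mul (hL a b) h1 (abs_nonneg _) hκ
    linarith [(abs_le.1 h2).1]
  calc -(3 * κ) * ∑ r, ∑ c, D r c ^ 2
      = ∑ a, ∑ b, ∑ r, -κ * ((D r a ^ 2 + D r b ^ 2) / 2) := by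
        simp only [Fin.sum_univ_three]; ring
    _ ≤ ∑ a, ∑ b, ∑ r, L a b * (D r a * D r b) := by
        exact Finset.sum_le_sum fun a _ => Finset.sum_le_sum fun b _ =>
          Finset.sum_le_sum fun r _ => key a b r
    _ = _ := by simp only [Matrix.mul_apply, Matrix.transpose_apply, Finset.mul_sum]

namespace PoseLocalization

variable {Np Nm : ℕ} (P : PoseLocalization Np Nm)

/-! ### The least-squares cost as a quadratic form -/

/-- The bilinear form `⟨u, v⟩ = ∑ uₑᵀ Wₑ vₑ` on stacked measurements. -/
def weightForm : P.Measurements →ₗ[ℝ] P.Measurements →ₗ[ℝ] ℝ :=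
  LinearMap.mk₂ ℝ
    (fun u v => ∑ e : P.edges, (fun r => u (e, r)) ⬝ᵥ (P.weight e *ᵥ fun r => v (e, r)))
    (fun u u' v => by
      rw [← Finset.sum_add_distrib]
      exact Finset.sum_congr rfl fun e _ => by rw [← add_dotProduct]; rfl)
    (fun c u v => by
      rw [smul_eq_mul, Finset.mul_sum]
      exact Finset.sum_congr rfl fun e _ => by rw [← smul_eq_mul, ← smul_dotProduct]; rfl)
    (fun u v v' => by
      rw [← Finset.sum_add_distrib]
      exact Finset.sum_congr rfl fun e _ => by
        rw [← dotProduct_add, ← Matrix.mulVec_add]; rfl)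
    (fun c u v => by
      rw [smul_eq_mul, Finset.mul_sum]
      exact Finset.sum_congr rfl fun e _ => by
        rw [← smul_eq_mul, ← dotProduct_smul, ← Matrix.mulVec_smul]; rfl)

theorem weightForm_apply (u v : P.Measurements) :
    P.weightForm u v =
      ∑ e : P.edges, (fun r => u (e, r)) ⬝ᵥ (P.weight e *ᵥ fun r => v (e, r)) := rfl

/-- `noiseFree` as a linear map. -/
def noiseFreeLin : Poses Np →ₗ[ℝ] P.Measurements where
  toFun := P.noiseFree
  map_add' x y := by
    ext er
    simp [noiseFree, Matrix.add_mulVec]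
    ring
  map_smul' c x := by
    ext er
    simp [noiseFree, Matrix.smul_mulVec]
    ring

theorem noiseFreeLin_apply (x : Poses Np) : P.noiseFreeLin x = P.noiseFree x := rfl

theorem noiseFree_apply (x : Poses Np) (e : P.edges) (r : Fin 3) :
    P.noiseFree x (e, r) = ∑ c, (x e.1.1).1 r c * P.landmark e.1.2 c - (x e.1.1).2 r := rfl

theorem cost_eq_weightForm (m : P.Measurements) (x : Poses Np) :
    P.cost m x = P.weightForm (m - P.noiseFreeLin x) (m - P.noiseFreeLin x) := by
  have h : ∀ e, P.err m x e = fun r => (m - P.noiseFreeLin x) (e, r) := fun e => by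
    ext r
    simp [err, noiseFreeLin_apply, noiseFree]
    ring
  simp only [cost, h, weightForm_apply]

variable {P}

theorem weightForm_comm (hW : ∀ e, (P.weight e).PosDef) (u v : P.Measurements) :
    P.weightForm u v = P.weightForm v u := by
  rw [weightForm_apply, weightForm_apply]
  refine Finset.sum_congr rfl fun e _ => ?_
  have h : (P.weight e)ᵀ = P.weight e := by
    simpa [Matrix.conjTranspose_eq_transpose_of_trivial] using (hW e).isHermitian.eq
  rw [Matrix.dotProduct_mulVec, ← Matrix.mulVec_transpose, h, dotProduct_comm]

theorem weightForm_self_smul_sub (hW : ∀ e, (P.weight e).PosDef) (w : ℝ) (u v : P.Measurements) :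
    P.weightForm (w • u - v) (w • u - v) =
      w ^ 2 * P.weightForm u u - 2 * w * P.weightForm v u + P.weightForm v v := by
  simp only [map_sub, map_smul, LinearMap.sub_apply, LinearMap.smul_apply, smul_eq_mul,
    weightForm_comm hW u v]
  ring

variable (P) in
theorem continuous_weightForm_self : Continuous fun v => P.weightForm v v := by
  simp only [weightForm_apply, dotProduct, Matrix.mulVec]
  fun_prop

theorem weightForm_self_pos (hW : ∀ e, (P.weight e).PosDef) {v : P.Measurements} (hv : v ≠ 0) :
    0 < P.weightForm v v := by
  obtain ⟨⟨e, r⟩, her⟩ : ∃ er, v er ≠ 0 := by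
    by_contra! h
    exact hv (by ext er; simpa using h er)
  rw [weightForm_apply]
  refine Finset.sum_pos' (fun e' _ => ?_) ⟨e, Finset.mem_univ e, ?_⟩
  · simpa using (hW e').posSemidef.dotProduct_mulVec_nonneg fun r => v (e', r)
  · simpa using (hW e).dotProduct_mulVec_pos (x := fun r => v (e, r)) fun h => her (congrFun h r)

theorem exists_pos_mul_norm_sq_le_weightForm (hW : ∀ e, (P.weight e).PosDef) :
    ∃ μ : ℝ, 0 < μ ∧ ∀ v, μ * ‖v‖ ^ 2 ≤ P.weightForm v v :=
  exists_pos_mul_norm_sq_le _ P.continuous_weightForm_self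
    (fun c v => by simp only [map_smul, LinearMap.smul_apply, smul_eq_mul]; ring)
    (fun _ hv => weightForm_self_pos hW hv)

/-- Noise-free measurements of landmarks in general position determine the poses. Here `x` ranges
over arbitrary matrices and vectors, not only over rotations. -/
theorem eq_zero_of_noiseFreeLin_eq_zero
    (hL : ∀ i : Fin Np, ¬ Coplanar ℝ (P.landmark '' {k | (i, k) ∈ P.edges})) {x : Poses Np}
    (hx : P.noiseFreeLin x = 0) : x = 0 := by
  have key : ∀ i k, (i, k) ∈ P.edges → ∀ r, (x i).1 r ⬝ᵥ P.landmark k = (x i).2 r := by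
    intro i k hik r
    have h1 : P.noiseFreeLin x (⟨(i, k), hik⟩, r) = 0 := by rw [hx]; rfl
    rw [noiseFreeLin_apply, noiseFree_apply] at h1
    simp only [dotProduct]
    linarith
  funext i
  have hC : (x i).1 = 0 := by
    ext r c
    by_contra hne
    refine hL i (coplanar_of_dotProduct_eq (u := (x i).1 r) (fun h => hne (congrFun h c))
      ((x i).2 r) ?_)
    rintro _ ⟨k, hk, rfl⟩
    exact key i k hk r
  obtain ⟨k, hk⟩ : ∃ k, (i, k) ∈ P.edges := by
    by_contra! h
    exact hL i (by simp [h, coplanar_empty])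
  refine Prod.ext hC (funext fun r => ?_)
  rw [← key i k hk r, hC]
  exact zero_dotProduct _

/-- The sum of the squares of all coordinates. -/
def sqNorm (y : Poses Np) : ℝ := ∑ i, (∑ r, ∑ c, (y i).1 r c ^ 2 + ∑ r, (y i).2 r ^ 2)

theorem sqNorm_nonneg (y : Poses Np) : 0 ≤ sqNorm y := by
  unfold sqNorm; positivity

theorem sqNorm_eq_zero {y : Poses Np} (h : sqNorm y = 0) : y = 0 := by
  have hz := (Finset.sum_eq_zero_iff_of_nonneg (fun i _ => by positivity)).1 h
  funext i
  have hi := hz i (Finset.mem_univ i)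
  have h1 : ∀ r c, 0 ≤ (y i).1 r c ^ 2 := fun r c => sq_nonneg _
  have h2 : ∀ r, 0 ≤ (y i).2 r ^ 2 := fun r => sq_nonneg _
  rw [add_eq_zero_iff_of_nonneg (by positivity) (by positivity)] at hi
  obtain ⟨ha, hb⟩ := hi
  refine Prod.ext ?_ ?_
  · ext r c
    have h3 := (Finset.sum_eq_zero_iff_of_nonneg (fun r _ => by positivity)).1 ha r
      (Finset.mem_univ r)
    have h4 := (Finset.sum_eq_zero_iff_of_nonneg (fun c _ => by positivity)).1 h3 c
      (Finset.mem_univ c)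
    simpa using h4
  · ext r
    have h3 := (Finset.sum_eq_zero_iff_of_nonneg (fun r _ => by positivity)).1 hb r
      (Finset.mem_univ r)
    simpa using h3

/-- The noise-free quadratic form is positive definite, with a constant that involves neither the
poses nor the measurements. The stability radius is uniform for this reason. -/
theorem exists_pos_mul_sqNorm_le (hW : ∀ e, (P.weight e).PosDef)
    (hL : ∀ i : Fin Np, ¬ Coplanar ℝ (P.landmark '' {k | (i, k) ∈ P.edges})) :
    ∃ δ : ℝ, 0 < δ ∧
      ∀ y, δ * sqNorm y ≤ P.weightForm (P.noiseFreeLin y) (P.noiseFreeLin y) := by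
  let κ := Fin Np × ((Fin 3 × Fin 3) ⊕ Fin 3)
  let F : EuclideanSpace ℝ κ →ₗ[ℝ] Poses Np :=
    { toFun := fun v i => (Matrix.of fun r c => v (i, Sum.inl (r, c)), fun r => v (i, Sum.inr r))
      map_add' := fun _ _ => rfl
      map_smul' := fun _ _ => rfl }
  have hF : ∀ v, sqNorm (F v) = ‖v‖ ^ 2 := fun v => by
    rw [EuclideanSpace.real_norm_sq_eq, Fintype.sum_prod_type]
    simp only [Fintype.sum_sum_type, Fintype.sum_prod_type]
    rfl
  have hcont : Continuous (P.noiseFreeLin ∘ₗ F) := LinearMap.continuous_of_finiteDimensional _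
  obtain ⟨δ, hδ, h⟩ := exists_pos_mul_norm_sq_le
    (fun v => P.weightForm (P.noiseFreeLin (F v)) (P.noiseFreeLin (F v)))
    (P.continuous_weightForm_self.comp hcont)
    (fun c v => by simp only [map_smul, LinearMap.smul_apply, smul_eq_mul]; ring)
    (fun v hv => weightForm_self_pos hW fun h0 => hv (by
      have h1 := hF v
      rw [eq_zero_of_noiseFreeLin_eq_zero hL h0,
        show sqNorm (0 : Poses Np) = 0 by simp [sqNorm]] at h1
      exact norm_eq_zero.1 (pow_eq_zero_iff two_ne_zero |>.1 h1.symm)))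
  refine ⟨δ, hδ, fun y => ?_⟩
  have hy : F (WithLp.toLp 2 fun j => match j with
    | (i, Sum.inl (r, c)) => (y i).1 r c
    | (i, Sum.inr r) => (y i).2 r) = y := rfl
  have h2 := h (WithLp.toLp 2 fun j => match j with
    | (i, Sum.inl (r, c)) => (y i).1 r c
    | (i, Sum.inr r) => (y i).2 r)
  rwa [← hF, hy] at h2

/-! ### Existence of a minimizer -/

theorem isClosed_feasible : IsClosed (feasible (Np := Np)) := by
  have h : feasible (Np := Np) = ⋂ i, ({x | (x i).1ᵀ * (x i).1 = 1} ∩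
      {x | crossProduct ((x i).1.col 0) ((x i).1.col 1) - (x i).1.col 2 = 0}) := by
    ext x; simp [feasible]
  rw [h]
  refine isClosed_iInter fun i => (isClosed_eq (by fun_prop) continuous_const).inter
    (isClosed_eq ?_ continuous_const)
  refine continuous_pi fun r => ?_
  fin_cases r <;> simp [cross_apply] <;> fun_prop

variable (P) in
theorem continuous_cost (m : P.Measurements) : Continuous (P.cost m) := by
  unfold cost err
  simp only [dotProduct, Matrix.mulVec, Pi.add_apply, Pi.sub_apply]
  fun_prop

theorem exists_isSolution (hW : ∀ e, (P.weight e).PosDef)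
    (hL : ∀ i : Fin Np, ¬ Coplanar ℝ (P.landmark '' {k | (i, k) ∈ P.edges}))
    {x₀ : Poses Np} (hx₀ : x₀ ∈ feasible (Np := Np)) (m : P.Measurements) :
    ∃ x, P.IsSolution m x := by
  obtain ⟨μ, hμ, hle⟩ := exists_pos_mul_norm_sq_le_weightForm hW
  set ρ : ℝ := √(P.cost m x₀ / μ) with hρ
  set T : ℝ := ρ + ‖m‖ + ∑ k, ∑ c, |P.landmark k c| with hT
  let K : Set (Poses Np) := Set.pi Set.univ fun _ =>
    (Set.pi Set.univ fun _ => Set.pi Set.univ fun _ => Set.Icc (-1 : ℝ) 1) ×ˢ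
      (Set.pi Set.univ fun _ => Set.Icc (-T) T)
  have hK : IsCompact K := isCompact_univ_pi fun _ =>
    (isCompact_univ_pi fun _ => isCompact_univ_pi fun _ => isCompact_Icc).prod
      (isCompact_univ_pi fun _ => isCompact_Icc)
  -- Rotations have bounded entries, and a translation is bounded by any one of its residuals.
  have hmem : ∀ x ∈ feasible (Np := Np), P.cost m x ≤ P.cost m x₀ → x ∈ K := by
    intro x hx hc i _
    have hC := abs_entry_le_one_of_transpose_mul_self (hx i).1
    refine ⟨fun r _ c _ => abs_le.1 (hC r c), fun r _ => abs_le.1 ?_⟩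
    obtain ⟨k, hk⟩ : ∃ k, (i, k) ∈ P.edges := by
      by_contra! h
      exact hL i (by simp [h, coplanar_empty])
    have h1 : ‖m - P.noiseFreeLin x‖ ≤ ρ := by
      refine Real.le_sqrt_of_sq_le ?_
      rw [le_div_iff₀ hμ, mul_comm]
      exact (hle _).trans (P.cost_eq_weightForm m x ▸ hc)
    have h2 := PiLp.norm_apply_le (m - P.noiseFreeLin x) (⟨(i, k), hk⟩, r)
    have h3 := PiLp.norm_apply_le m (⟨(i, k), hk⟩, r)
    rw [PiLp.sub_apply, noiseFreeLin_apply, noiseFree_apply] at h2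
    simp only [Real.norm_eq_abs] at h2 h3
    have h4 : |∑ c, (x i).1 r c * P.landmark k c| ≤ ∑ k, ∑ c, |P.landmark k c| := by
      refine (Finset.abs_sum_le_sum_abs _ _).trans (le_trans (Finset.sum_le_sum fun c _ => ?_)
        (Finset.single_le_sum (f := fun k => ∑ c, |P.landmark k c|)
          (fun _ _ => by positivity) (Finset.mem_univ k)))
      rw [abs_mul]
      exact mul_le_of_le_one_left (abs_nonneg _) (hC r c)
    rw [noiseFreeLin_apply] at h1
    rw [abs_le] at *
    constructor <;> linarith [h2.1, h2.2, h3.1, h3.2, h4.1, h4.2]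
  obtain ⟨x, hx, hmin⟩ := (hK.inter_right isClosed_feasible).exists_isMinOn
    ⟨x₀, hmem x₀ hx₀ le_rfl, hx₀⟩ (P.continuous_cost m).continuousOn
  refine ⟨x, hx.2, fun y hy => ?_⟩
  rcases le_total (P.cost m y) (P.cost m x₀) with h | h
  · exact hmin ⟨hmem y hy h, hy⟩
  · exact (hmin ⟨hmem x₀ hx₀ le_rfl, hx₀⟩ : P.cost m x ≤ P.cost m x₀).trans h

/-! ### First-order optimality on the rotation group -/

/-- First-order optimality along a curve `τ ↦ x + τ γ(τ)` of feasible points: the directional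
derivative of the cost, a negative multiple of the left-hand side, is nonnegative. -/
theorem weightForm_residual_nonpos (hW : ∀ e, (P.weight e).PosDef) {m : P.Measurements}
    {x : Poses Np} (hx : P.IsSolution m x) {γ : ℝ → Poses Np} (hγ : Continuous γ)
    (hfeas : ∀ τ, 0 < τ → x + τ • γ τ ∈ feasible (Np := Np)) :
    P.weightForm (P.noiseFreeLin (γ 0)) (m - P.noiseFreeLin x) ≤ 0 := by
  set u := m - P.noiseFreeLin x with hu
  -- `φ τ` is the change of the cost from `x` to `x + τ γ(τ)`, divided by `τ`.
  let φ : ℝ → ℝ := fun τ => τ * P.weightForm (P.noiseFreeLin (γ τ)) (P.noiseFreeLin (γ τ)) -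
    2 * P.weightForm (P.noiseFreeLin (γ τ)) u
  have hN : Continuous fun τ => P.noiseFreeLin (γ τ) :=
    (LinearMap.continuous_of_finiteDimensional P.noiseFreeLin).comp hγ
  have hφ : Continuous φ :=
    (continuous_id.mul (P.continuous_weightForm_self.comp hN)).sub (continuous_const.mul
      ((LinearMap.continuous_of_finiteDimensional (P.weightForm.flip u)).comp hN))
  have hpos : ∀ τ ∈ Set.Ioi (0 : ℝ), 0 ≤ φ τ := by
    intro τ hτ
    have h1 : P.cost m x ≤ P.cost m (x + τ • γ τ) := hx.2 (hfeas τ hτ)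
    have h2 := weightForm_self_smul_sub hW 1 u (P.noiseFreeLin (τ • γ τ))
    rw [cost_eq_weightForm, cost_eq_weightForm, map_add, ← sub_sub, ← hu] at h1
    simp only [one_smul] at h2
    rw [h2] at h1
    simp only [map_smul, LinearMap.smul_apply, smul_eq_mul] at h1
    have h3 : 0 ≤ τ * φ τ := by simp only [φ]; linarith
    exact nonneg_of_mul_nonneg_right h3 hτ
  have h0 : 0 ≤ φ 0 := by
    have hmem : (0 : ℝ) ∈ closure (Set.Ioi 0) := by rw [closure_Ioi]; exact Set.self_mem_Ici
    exact closure_minimal (s := Set.Ioi (0 : ℝ)) hpos (isClosed_le continuous_const hφ) hmem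
  simp only [φ] at h0
  linarith

theorem weightForm_translation_eq_zero (hW : ∀ e, (P.weight e).PosDef) {m : P.Measurements}
    {x : Poses Np} (hx : P.IsSolution m x) {y : Poses Np} (hy : ∀ i, (y i).1 = 0) :
    P.weightForm (P.noiseFreeLin y) (m - P.noiseFreeLin x) = 0 := by
  have key : ∀ y : Poses Np, (∀ i, (y i).1 = 0) →
      P.weightForm (P.noiseFreeLin y) (m - P.noiseFreeLin x) ≤ 0 := fun y hy =>
    weightForm_residual_nonpos hW hx (γ := fun _ => y) continuous_const fun τ _ i => by
      have h : ((x + τ • y) i).1 = (x i).1 := by simp [hy i]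
      rw [h]
      exact hx.1 i
  have h := key (-y) fun i => by simp [hy i]
  rw [map_neg, map_neg, LinearMap.neg_apply] at h
  exact le_antisymm (key y hy) (by linarith)

theorem mul_cayley_mem {C : Matrix (Fin 3) (Fin 3) ℝ}
    (hC : Cᵀ * C = 1 ∧ crossProduct (C.col 0) (C.col 1) - C.col 2 = 0) (a : Fin 3 → ℝ) :
    (C * cayley a)ᵀ * (C * cayley a) = 1 ∧
      crossProduct ((C * cayley a).col 0) ((C * cayley a).col 1) - (C * cayley a).col 2 = 0 := by
  have h : (C * cayley a)ᵀ * (C * cayley a) = 1 := by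
    rw [Matrix.transpose_mul, Matrix.mul_assoc, ← Matrix.mul_assoc Cᵀ, hC.1, Matrix.one_mul,
      cayley_transpose_mul_self]
  refine ⟨h, (crossProduct_col_eq_iff_det_eq_one h).2 ?_⟩
  rw [Matrix.det_mul, det_cayley, (crossProduct_col_eq_iff_det_eq_one hC.1).1 hC.2, one_mul]

theorem weightForm_rotation_eq_zero (hW : ∀ e, (P.weight e).PosDef) {m : P.Measurements}
    {x : Poses Np} (hx : P.IsSolution m x) (i : Fin Np) (a : Fin 3 → ℝ) :
    P.weightForm (P.noiseFreeLin (Pi.single i ((x i).1 * skew a, 0)))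
      (m - P.noiseFreeLin x) = 0 := by
  have key : ∀ a, P.weightForm (P.noiseFreeLin (Pi.single i ((2 : ℝ) • ((x i).1 * skew a), 0)))
      (m - P.noiseFreeLin x) ≤ 0 := by
    intro a
    let c : ℝ → ℝ := fun τ => 2 / (1 + (τ • a) ⬝ᵥ (τ • a))
    have hc : Continuous c := by
      refine continuous_const.div (by fun_prop) fun τ => ?_
      exact (add_pos_of_pos_of_nonneg one_pos (Finset.sum_nonneg fun _ _ => mul_self_nonneg _)).ne'
    let γ : ℝ → Poses Np := fun τ =>
      Pi.single i (c τ • ((x i).1 * (skew a + τ • (skew a * skew a))), 0)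
    have hγ : Continuous γ := by
      refine (continuous_single i).comp (Continuous.prodMk ?_ continuous_const)
      fun_prop
    have h := weightForm_residual_nonpos hW hx hγ fun τ _ j => by
      by_cases hj : j = i
      · subst hj
        have h1 : ((x + τ • γ τ) j).1 = (x j).1 * cayley (τ • a) := by
          simp only [γ, c, cayley, skew_smul, Pi.add_apply, Pi.smul_apply, Pi.single_eq_same,
            Prod.fst_add, Prod.smul_fst]
          simp only [Matrix.mul_add, Matrix.mul_smul, Matrix.smul_mul, smul_add, smul_smul,
            Matrix.mul_one]
          ring_nf
        rw [h1]
        exact mul_cayley_mem (hx.1 j) _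
      · have h1 : (x + τ • γ τ) j = x j := by simp [γ, hj]
        rw [h1]
        exact hx.1 j
    simpa [γ, c] using h
  have hlin : ∀ (s : ℝ) (M : Matrix (Fin 3) (Fin 3) ℝ),
      P.weightForm (P.noiseFreeLin (Pi.single i (s • M, 0))) (m - P.noiseFreeLin x) =
        s * P.weightForm (P.noiseFreeLin (Pi.single i (M, 0))) (m - P.noiseFreeLin x) := by
    intro s M
    have h : (Pi.single i (s • M, 0) : Poses Np) = s • Pi.single i (M, 0) := by
      rw [← Pi.single_smul]; simp
    rw [h, map_smul, map_smul, LinearMap.smul_apply, smul_eq_mul]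
  -- The curves through `a` and `-a` leave `x` in opposite directions.
  have h1 := key a
  have h2 := key (-a)
  have h3 : (x i).1 * skew (-a) = (-1 : ℝ) • ((x i).1 * skew a) := by simp [skew_neg]
  rw [h3, hlin, hlin] at h2
  rw [hlin] at h1
  linarith

variable (P) in
/-- The moment `∑ Wₑ uₑ pₑᵀ` of a stacked measurement vector, over the edges of the pose `i`.
For a residual `u` it is a multiple of the gradient of the cost in the matrix `C i`. -/
def moment (u : P.Measurements) (i : Fin Np) : Matrix (Fin 3) (Fin 3) ℝ :=
  ∑ e : P.edges with e.1.1 = i,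
    Matrix.vecMulVec (P.weight e *ᵥ fun r => u (e, r)) (P.landmark e.1.2)

theorem weightForm_eq_sum_trace_moment {y : Poses Np} (hy : ∀ i, (y i).2 = 0)
    (u : P.Measurements) :
    P.weightForm (P.noiseFreeLin y) u = ∑ i, ((P.moment u i)ᵀ * (y i).1).trace := by
  have h1 : ∀ i, ((P.moment u i)ᵀ * (y i).1).trace = ∑ e : P.edges with e.1.1 = i,
      (fun r => P.noiseFreeLin y (e, r)) ⬝ᵥ (P.weight e *ᵥ fun r => u (e, r)) := by
    intro i
    rw [moment, Matrix.transpose_sum, Finset.sum_mul, Matrix.trace_sum]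
    refine Finset.sum_congr rfl fun e he => ?_
    have hi : e.1.1 = i := (Finset.mem_filter.1 he).2
    have h2 : (fun r => P.noiseFreeLin y (e, r)) = (y i).1 *ᵥ P.landmark e.1.2 := by
      ext r
      rw [noiseFreeLin_apply, noiseFree_apply, hi, hy]
      simp [Matrix.mulVec, dotProduct]
    rw [h2, Matrix.transpose_vecMulVec, Matrix.vecMulVec_mul, Matrix.trace_vecMulVec,
      ← Matrix.mulVec_transpose, dotProduct_comm ((y i).1 *ᵥ _), Matrix.dotProduct_mulVec,
      ← Matrix.mulVec_transpose, dotProduct_comm, Matrix.transpose_transpose]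
  simp only [h1, weightForm_apply]
  exact (Finset.sum_fiberwise _ _ _).symm

/-- At a minimizer, `Cᵀ G` is symmetric, where `G` is the moment of the residual. It is the
multiplier matrix of the orthonormality constraint. -/
theorem isSymm_transpose_mul_moment (hW : ∀ e, (P.weight e).PosDef) {m : P.Measurements}
    {x : Poses Np} (hx : P.IsSolution m x) (i : Fin Np) :
    ((x i).1ᵀ * P.moment (m - P.noiseFreeLin x) i).IsSymm := by
  have h : ((P.moment (m - P.noiseFreeLin x) i)ᵀ * (x i).1).IsSymm := by
    refine isSymm_of_trace_mul_skew_eq_zero fun a => ?_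
    have h1 := weightForm_rotation_eq_zero hW hx i a
    rw [weightForm_eq_sum_trace_moment, Finset.sum_eq_single i] at h1
    · simpa [Matrix.mul_assoc] using h1
    · intro j _ hj
      simp [hj]
    · simp
    · intro j
      by_cases hj : j = i
      · subst hj; simp
      · simp [hj]
  have h2 := h.eq
  rw [Matrix.transpose_mul, Matrix.transpose_transpose] at h2
  rw [h2]
  exact h

variable (P) in
theorem exists_abs_transpose_mul_moment_le :
    ∃ B : ℝ, 0 ≤ B ∧ ∀ (C : Matrix (Fin 3) (Fin 3) ℝ), Cᵀ * C = 1 →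
      ∀ u i a b, |(Cᵀ * P.moment u i) a b| ≤ B * ‖u‖ := by
  refine ⟨∑ b, ∑ r, ∑ e : P.edges, (∑ c, |P.weight e r c|) * |P.landmark e.1.2 b|,
    by positivity, fun C hC u i a b => ?_⟩
  have hG : ∀ r, |P.moment u i r b| ≤
      ∑ e : P.edges, (∑ c, |P.weight e r c|) * |P.landmark e.1.2 b| * ‖u‖ := by
    intro r
    rw [moment, Matrix.sum_apply]
    refine (Finset.abs_sum_le_sum_abs _ _).trans (le_trans (Finset.sum_le_sum fun e _ => ?_)
      (Finset.sum_le_sum_of_subset_of_nonneg (Finset.filter_subset _ _)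
        fun _ _ _ => by positivity))
    rw [Matrix.vecMulVec_apply, abs_mul, mul_right_comm]
    gcongr
    rw [Matrix.mulVec, dotProduct, Finset.sum_mul]
    refine (Finset.abs_sum_le_sum_abs _ _).trans (Finset.sum_le_sum fun c _ => ?_)
    rw [abs_mul]
    gcongr
    exact PiLp.norm_apply_le u (e, c)
  calc |(Cᵀ * P.moment u i) a b| ≤ ∑ r, |P.moment u i r b| := by
        rw [Matrix.mul_apply]
        refine (Finset.abs_sum_le_sum_abs _ _).trans (Finset.sum_le_sum fun r _ => ?_)
        rw [abs_mul]
        exact mul_le_of_le_one_left (abs_nonneg _)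
          (abs_entry_le_one_of_transpose_mul_self hC r a)
    _ ≤ ∑ r, ∑ e : P.edges, (∑ c, |P.weight e r c|) * |P.landmark e.1.2 b| * ‖u‖ :=
        Finset.sum_le_sum fun r _ => hG r
    _ = (∑ r, ∑ e : P.edges, (∑ c, |P.weight e r c|) * |P.landmark e.1.2 b|) * ‖u‖ := by
        simp only [Finset.sum_mul]
    _ ≤ _ := by
        refine mul_le_mul_of_nonneg_right ?_ (norm_nonneg u)
        exact Finset.single_le_sum (f := fun b => ∑ r, ∑ e : P.edges,
          (∑ c, |P.weight e r c|) * |P.landmark e.1.2 b|) (fun _ _ => by positivity)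
          (Finset.mem_univ b)

/-! ### The quadratic forms of the homogenized problem -/

/-- The pose coordinates `(C i, t i)` of a vector `z = (vec (C i), t i, w)`. -/
def posePart (z : Idx Np → ℝ) : Poses Np :=
  fun i => (Matrix.of fun r c => z (idxC i r c), fun r => z (idxT i r))

/-- The vector `z = (vec (C i), t i, 1)` of the poses `x`. -/
def homogenize (x : Poses Np) : Idx Np → ℝ
  | Sum.inl (i, Sum.inl (r, c)) => (x i).1 r c
  | Sum.inl (i, Sum.inr r) => (x i).2 r
  | Sum.inr _ => 1

theorem posePart_homogenize (x : Poses Np) : posePart (homogenize x) = x := rfl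

theorem homogenize_idxW (x : Poses Np) : homogenize x idxW = 1 := rfl

theorem eq_smul_homogenize {z : Idx Np → ℝ} {x : Poses Np}
    (h : posePart z = z idxW • x) : z = z idxW • homogenize x := by
  funext j
  rcases j with ⟨i, ⟨r, c⟩ | r⟩ | _
  · exact congrFun (congrFun (congrArg Prod.fst (congrFun h i)) r) c
  · exact congrFun (congrArg Prod.snd (congrFun h i)) r
  · simp [homogenize, idxW]

theorem dotProduct_mono_mulVec (a b : Idx Np) (z : Idx Np → ℝ) :
    z ⬝ᵥ (mono a b *ᵥ z) = z a * z b := by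
  simp [mono, Matrix.add_mulVec, Matrix.single_mulVec_eq, dotProduct_add]
  ring

theorem isSymm_mono (a b : Idx Np) : (mono a b).IsSymm := by
  simp [mono, Matrix.IsSymm, add_comm]

theorem dotProduct_orthMatrix_mulVec (i : Fin Np) (a b : Fin 3) (z : Idx Np → ℝ) :
    z ⬝ᵥ (orthMatrix i a b *ᵥ z) =
      ((posePart z i).1ᵀ * (posePart z i).1) a b - if a = b then z idxW * z idxW else 0 := by
  rw [orthMatrix, Matrix.sub_mulVec, dotProduct_sub, Matrix.sum_mulVec, dotProduct_sum]
  simp only [dotProduct_mono_mulVec, apply_ite (fun M => z ⬝ᵥ (M *ᵥ z)), Matrix.zero_mulVec,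
    dotProduct_zero]
  rfl

theorem isSymm_orthMatrix (i : Fin Np) (a b : Fin 3) : (orthMatrix i a b).IsSymm := by
  rw [Matrix.IsSymm, orthMatrix, Matrix.transpose_sub, Matrix.transpose_sum]
  simp only [apply_ite Matrix.transpose, Matrix.transpose_zero, (isSymm_mono _ _).eq]

theorem dotProduct_crossMatrix_mulVec (i : Fin Np) (r : Fin 3) (z : Idx Np → ℝ) :
    z ⬝ᵥ (crossMatrix i r *ᵥ z) =
      (crossProduct ((posePart z i).1.col 0) ((posePart z i).1.col 1)
        - z idxW • (posePart z i).1.col 2) r := by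
  rw [crossMatrix, Matrix.sub_mulVec, Matrix.sub_mulVec, dotProduct_sub, dotProduct_sub]
  simp only [dotProduct_mono_mulVec]
  fin_cases r <;> simp [cross_apply, posePart]

theorem isSymm_crossMatrix (i : Fin Np) (r : Fin 3) : (crossMatrix (Np := Np) i r).IsSymm :=
  ((isSymm_mono _ _).sub (isSymm_mono _ _)).sub (isSymm_mono _ _)

theorem errMatrix_mulVec (m : P.Measurements) (e : P.edges) (z : Idx Np → ℝ) :
    P.errMatrix m e *ᵥ z = fun r => (z idxW • m - P.noiseFreeLin (posePart z)) (e, r) := by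
  ext r
  rw [PiLp.sub_apply, PiLp.smul_apply, noiseFreeLin_apply, noiseFree_apply]
  simp only [Matrix.mulVec, dotProduct, errMatrix, Matrix.of_apply, Fintype.sum_sum_type,
    Fintype.sum_prod_type, ite_mul, zero_mul, ite_and, Finset.sum_ite_eq', Finset.sum_ite_irrel,
    Finset.sum_const_zero, Finset.mem_univ, if_true, Finset.sum_add_distrib]
  simp [posePart, idxC, idxT, idxW, mul_comm]
  ring

theorem dotProduct_costMatrix_mulVec (m : P.Measurements) (z : Idx Np → ℝ) :
    z ⬝ᵥ (P.costMatrix m *ᵥ z) =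
      P.weightForm (z idxW • m - P.noiseFreeLin (posePart z))
        (z idxW • m - P.noiseFreeLin (posePart z)) := by
  rw [costMatrix, Matrix.sum_mulVec, dotProduct_sum, weightForm_apply]
  refine Finset.sum_congr rfl fun e _ => ?_
  rw [← errMatrix_mulVec, Matrix.mul_assoc, ← Matrix.mulVec_mulVec, Matrix.dotProduct_mulVec,
    Matrix.vecMul_transpose, ← Matrix.mulVec_mulVec]

theorem isSymm_costMatrix (hW : ∀ e, (P.weight e).PosDef) (m : P.Measurements) :
    (P.costMatrix m).IsSymm := by
  rw [Matrix.IsSymm, costMatrix, Matrix.transpose_sum]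
  refine Finset.sum_congr rfl fun e _ => ?_
  have h : (P.weight e)ᵀ = P.weight e := by
    simpa [Matrix.conjTranspose_eq_transpose_of_trivial] using (hW e).isHermitian.eq
  rw [Matrix.transpose_mul, Matrix.transpose_mul, h, Matrix.transpose_transpose,
    Matrix.mul_assoc]

theorem homogenize_mem_feasible {x : Poses Np} (hx : x ∈ feasible (Np := Np))
    (m : P.Measurements) : homogenize x ∈ (P.toQCQP m).feasible := by
  refine ⟨?_, ?_⟩
  · rintro ⟨i, ⟨a, b⟩ | r⟩
    · simp only [toQCQP, dotProduct_orthMatrix_mulVec, posePart_homogenize, (hx i).1,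
        homogenize_idxW, Matrix.one_apply, mul_one, sub_self]
    · simp only [toQCQP, dotProduct_crossMatrix_mulVec, posePart_homogenize, homogenize_idxW,
        one_smul, (hx i).2, Pi.zero_apply]
  · simp only [toQCQP, dotProduct_mono_mulVec, homogenize_idxW, mul_one]

theorem cost_homogenize (m : P.Measurements) (x : Poses Np) :
    (P.toQCQP m).cost (homogenize x) = P.cost m x := by
  rw [cost_eq_weightForm]
  exact (dotProduct_costMatrix_mulVec m _).trans (by
    rw [posePart_homogenize, homogenize_idxW, one_smul])

/-! ### The dual certificate -/

/-- The dual variables that belong to the poses `x`: the multiplier matrix `Cᵀ G` on each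
orthonormality constraint, with `G` the moment of the residual, zero on the cross product
constraints, and minus the cost for the homogenizing constraint. -/
def multipliers (m : P.Measurements) (x : Poses Np) :
    (Fin Np × ((Fin 3 × Fin 3) ⊕ Fin 3) → ℝ) × ℝ :=
  (fun j => match j with
    | (i, Sum.inl (a, b)) => ((x i).1ᵀ * P.moment (m - P.noiseFreeLin x) i) a b
    | (_, Sum.inr _) => 0,
   -P.cost m x)

theorem sum_mul_eq_trace (L M : Matrix (Fin 3) (Fin 3) ℝ) :
    ∑ a, ∑ b, L a b * M a b = (Lᵀ * M).trace := by
  simp only [Matrix.trace, Matrix.diag_apply, Matrix.mul_apply, Matrix.transpose_apply]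
  exact Finset.sum_comm

/-- First-order optimality removes from the Lagrangian all terms that are linear in the deviation
`y` of `z` from the multiple `w x` of the minimizer; what remains is a quadratic form in `y`. -/
theorem dotProduct_dualMatrix_multipliers (hW : ∀ e, (P.weight e).PosDef) {m : P.Measurements}
    {x : Poses Np} (hx : P.IsSolution m x) (z : Idx Np → ℝ) {y : Poses Np}
    (hz : posePart z = z idxW • x + y) :
    z ⬝ᵥ ((P.toQCQP m).dualMatrix (multipliers m x).1 (multipliers m x).2 *ᵥ z) =
      P.weightForm (P.noiseFreeLin y) (P.noiseFreeLin y) +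
        ∑ i, ∑ a, ∑ b, ((x i).1ᵀ * P.moment (m - P.noiseFreeLin x) i) a b *
          ((y i).1ᵀ * (y i).1) a b := by
  set w := z idxW with hw
  set u := m - P.noiseFreeLin x with hu
  set L : Fin Np → Matrix (Fin 3) (Fin 3) ℝ := fun i => (x i).1ᵀ * P.moment u i with hLdef
  have hLsymm : ∀ i, (L i)ᵀ = L i := fun i => (isSymm_transpose_mul_moment hW hx i).eq
  have hcost : (P.toQCQP m).cost z =
      w ^ 2 * P.cost m x - 2 * w * P.weightForm (P.noiseFreeLin y) u +
        P.weightForm (P.noiseFreeLin y) (P.noiseFreeLin y) := by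
    have h1 : w • m - P.noiseFreeLin (posePart z) = w • u - P.noiseFreeLin y := by
      rw [hz, map_add, map_smul, hu, smul_sub]; abel
    have h2 := dotProduct_costMatrix_mulVec m z
    rw [← hw, h1, weightForm_self_smul_sub hW, ← cost_eq_weightForm] at h2
    exact h2
  -- The term linear in `y`: translations contribute nothing, rotations the multiplier terms.
  have hlin : P.weightForm (P.noiseFreeLin y) u = ∑ i, (L i * ((x i).1ᵀ * (y i).1)).trace := by
    let yC : Poses Np := fun i => ((y i).1, 0)
    let yT : Poses Np := fun i => (0, (y i).2)
    have hy : y = yC + yT := by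
      funext i; ext <;> simp [yC, yT]
    rw [hy, map_add, map_add, LinearMap.add_apply,
      weightForm_translation_eq_zero hW hx (y := yT) fun _ => rfl, add_zero,
      weightForm_eq_sum_trace_moment (y := yC) fun _ => rfl, ← hy]
    refine Finset.sum_congr rfl fun i _ => ?_
    have h1 : L i * (x i).1ᵀ = (P.moment u i)ᵀ := by
      rw [← hLsymm i]
      simp only [hLdef]
      rw [Matrix.transpose_mul, Matrix.transpose_transpose, Matrix.mul_assoc,
        mul_eq_one_comm.1 (hx.1 i).1, Matrix.mul_one]
    rw [← Matrix.mul_assoc, h1]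
  have horth : ∀ i a b, z ⬝ᵥ (orthMatrix i a b *ᵥ z) =
      w * (((x i).1ᵀ * (y i).1) a b + ((y i).1ᵀ * (x i).1) a b) + ((y i).1ᵀ * (y i).1) a b := by
    intro i a b
    have h1 : (posePart z i).1ᵀ * (posePart z i).1 = (w * w) • (1 : Matrix (Fin 3) (Fin 3) ℝ) +
        w • ((x i).1ᵀ * (y i).1 + (y i).1ᵀ * (x i).1) + (y i).1ᵀ * (y i).1 := by
      rw [hz, ← (hx.1 i).1]
      simp only [Pi.add_apply, Pi.smul_apply, Prod.fst_add, Prod.smul_fst, Matrix.transpose_add,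
        Matrix.transpose_smul, Matrix.add_mul, Matrix.mul_add, Matrix.smul_mul, Matrix.mul_smul,
        smul_smul, smul_add]
      abel
    rw [dotProduct_orthMatrix_mulVec, h1, ← hw]
    simp only [Matrix.add_apply, Matrix.smul_apply, Matrix.one_apply, smul_eq_mul]
    split_ifs <;> ring
  have hcross : ∀ i, ∑ a, ∑ b, L i a b * ((x i).1ᵀ * (y i).1) a b =
        (L i * ((x i).1ᵀ * (y i).1)).trace ∧
      ∑ a, ∑ b, L i a b * ((y i).1ᵀ * (x i).1) a b =
        (L i * ((x i).1ᵀ * (y i).1)).trace := by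
    intro i
    refine ⟨by rw [sum_mul_eq_trace, hLsymm], ?_⟩
    rw [sum_mul_eq_trace, ← Matrix.trace_transpose, Matrix.transpose_mul, Matrix.transpose_mul,
      Matrix.transpose_transpose, Matrix.transpose_transpose, Matrix.trace_mul_comm]
  have hsum : ∑ j, (multipliers m x).1 j * (z ⬝ᵥ ((P.toQCQP m).A j *ᵥ z)) =
      2 * w * ∑ i, (L i * ((x i).1ᵀ * (y i).1)).trace +
        ∑ i, ∑ a, ∑ b, L i a b * ((y i).1ᵀ * (y i).1) a b := by
    rw [Fintype.sum_prod_type, Finset.mul_sum, ← Finset.sum_add_distrib]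
    refine Finset.sum_congr rfl fun i _ => ?_
    rw [Fintype.sum_sum_type, Fintype.sum_prod_type]
    simp only [multipliers, toQCQP, zero_mul, Finset.sum_const_zero, add_zero, horth]
    have h1 : ∀ a b, L i a b * (w * (((x i).1ᵀ * (y i).1) a b + ((y i).1ᵀ * (x i).1) a b) +
        ((y i).1ᵀ * (y i).1) a b) = w * (L i a b * ((x i).1ᵀ * (y i).1) a b) +
          w * (L i a b * ((y i).1ᵀ * (x i).1) a b) + L i a b * ((y i).1ᵀ * (y i).1) a b :=
      fun a b => by ring
    change ∑ a, ∑ b, L i a b * _ = _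
    simp only [h1, Finset.sum_add_distrib, ← Finset.mul_sum, (hcross i).1, (hcross i).2]
    ring
  rw [QCQP.dotProduct_dualMatrix_mulVec, hsum, hcost, hlin]
  have h0 : z ⬝ᵥ ((P.toQCQP m).A₀ *ᵥ z) = w * w := dotProduct_mono_mulVec _ _ _
  rw [h0]
  simp only [multipliers]
  ring

/-- The multipliers of a minimizer certify it as soon as they are small compared to the constant
`δ` of positive definiteness. -/
theorem isStrictCertificate_multipliers (hW : ∀ e, (P.weight e).PosDef) {m : P.Measurements}
    {x : Poses Np} (hx : P.IsSolution m x) {δ κ : ℝ}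
    (hδ : ∀ y, δ * sqNorm y ≤ P.weightForm (P.noiseFreeLin y) (P.noiseFreeLin y))
    (hκ : ∀ i a b, |((x i).1ᵀ * P.moment (m - P.noiseFreeLin x) i) a b| ≤ κ)
    (hκ0 : 0 ≤ κ) (hlt : 3 * κ < δ) :
    (P.toQCQP m).IsStrictCertificate (homogenize x) (multipliers m x) := by
  have hlow : ∀ z : Idx Np → ℝ, (δ - 3 * κ) * sqNorm (posePart z - z idxW • x) ≤
      z ⬝ᵥ ((P.toQCQP m).dualMatrix (multipliers m x).1 (multipliers m x).2 *ᵥ z) := by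
    intro z
    set y := posePart z - z idxW • x with hy
    rw [dotProduct_dualMatrix_multipliers hW hx z (y := y) (by rw [hy]; abel)]
    have h1 : -(3 * κ) * sqNorm y ≤ ∑ i, ∑ a, ∑ b,
        ((x i).1ᵀ * P.moment (m - P.noiseFreeLin x) i) a b * ((y i).1ᵀ * (y i).1) a b := by
      rw [sqNorm, Finset.mul_sum]
      refine Finset.sum_le_sum fun i _ => le_trans ?_ (neg_mul_sum_sq_le_sum_mul_gram (hκ i))
      have : 0 ≤ 3 * κ * ∑ r, (y i).2 r ^ 2 := by positivity
      linarith
    linarith [hδ y]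
  refine ⟨homogenize_mem_feasible hx.1 m, ?_, ?_, fun z hz => ⟨z idxW, ?_⟩⟩
  · refine Matrix.PosSemidef.of_dotProduct_mulVec_nonneg ?_ fun z => ?_
    · rw [Matrix.IsHermitian, Matrix.conjTranspose_eq_transpose_of_trivial, QCQP.dualMatrix,
        Matrix.transpose_add, Matrix.transpose_add, Matrix.transpose_sum, Matrix.transpose_smul]
      have hA : ∀ j, ((P.toQCQP m).A j)ᵀ = (P.toQCQP m).A j := by
        rintro ⟨i, ⟨a, b⟩ | r⟩
        · exact isSymm_orthMatrix i a b
        · exact isSymm_crossMatrix i r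
      have hA₀ : ((P.toQCQP m).A₀)ᵀ = (P.toQCQP m).A₀ := isSymm_mono _ _
      have hQ : ((P.toQCQP m).Q)ᵀ = (P.toQCQP m).Q := isSymm_costMatrix hW m
      simp only [Matrix.transpose_smul, hA, hA₀, hQ]
    · rw [star_trivial]
      exact (mul_nonneg (by linarith) (sqNorm_nonneg _)).trans (hlow z)
  · rw [dotProduct_dualMatrix_multipliers hW hx _ (y := 0)
      (by rw [posePart_homogenize, homogenize_idxW, one_smul, add_zero])]
    simp
  · have h1 := hlow z
    rw [hz] at h1
    have h2 : sqNorm (posePart z - z idxW • x) = 0 :=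
      le_antisymm (nonpos_of_mul_nonpos_right h1 (by linarith)) (sqNorm_nonneg _)
    exact eq_smul_homogenize (sub_eq_zero.1 (sqNorm_eq_zero h2))

/-- Noise below a threshold forces the residuals of every minimizer, hence its multipliers, to be
small, because a minimizer costs no more than `xbar`. -/
theorem exists_isStrictCertificate (hW : ∀ e, (P.weight e).PosDef)
    (hL : ∀ i : Fin Np, ¬ Coplanar ℝ (P.landmark '' {k | (i, k) ∈ P.edges})) :
    ∃ ε : ℝ, 0 < ε ∧ ∀ xbar ∈ feasible (Np := Np), ∀ m : P.Measurements,
      ‖m - P.noiseFree xbar‖ ^ 2 < ε → ∃ x, P.IsSolution m x ∧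
        (P.toQCQP m).IsStrictCertificate (homogenize x) (multipliers m x) := by
  obtain ⟨δ, hδ0, hδ⟩ := exists_pos_mul_sqNorm_le hW hL
  obtain ⟨μ, hμ0, hμ⟩ := exists_pos_mul_norm_sq_le_weightForm hW
  obtain ⟨B, hB0, hB⟩ := P.exists_abs_transpose_mul_moment_le
  -- `τ` bounds the residuals; it is chosen so that `3 * (B * τ) < δ`.
  set τ : ℝ := δ / (3 * (B + 1)) with hτ
  have hτ0 : 0 < τ := by positivity
  have hτδ : 3 * (B * τ) < δ := by
    have h1 : 3 * (B + 1) * τ = δ := by rw [hτ]; field_simp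
    linarith
  have hcont := P.continuous_weightForm_self.tendsto 0
  simp only [map_zero] at hcont
  obtain ⟨ε, hε0, hε⟩ := Metric.eventually_nhds_iff.1
    (hcont.eventually (gt_mem_nhds (show 0 < μ * τ ^ 2 by positivity)))
  refine ⟨ε ^ 2, by positivity, fun xbar hxbar m hm => ?_⟩
  obtain ⟨x, hx⟩ := exists_isSolution hW hL hxbar m
  refine ⟨x, hx, ?_⟩
  have h1 : P.cost m x < μ * τ ^ 2 := by
    refine (hx.2 hxbar : P.cost m x ≤ P.cost m xbar).trans_lt ?_
    rw [cost_eq_weightForm]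
    refine hε ?_
    rw [dist_zero_right]
    exact lt_of_pow_lt_pow_left₀ 2 hε0.le hm
  have h2 : ‖m - P.noiseFreeLin x‖ ≤ τ := by
    have h3 := (hμ (m - P.noiseFreeLin x)).trans_lt (P.cost_eq_weightForm m x ▸ h1)
    exact (lt_of_pow_lt_pow_left₀ 2 hτ0.le (lt_of_mul_lt_mul_left h3 hμ0.le)).le
  refine isStrictCertificate_multipliers hW hx hδ (κ := B * τ) (fun i a b => ?_)
    (by positivity) hτδ
  exact (hB _ (hx.1 i).1 _ i a b).trans (by gcongr)

/-! ### From the homogenized problem back to the poses -/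

theorem recover_vecMulVec_homogenize (x : Poses Np) :
    recover (Matrix.vecMulVec (homogenize x) (homogenize x)) = x := by
  funext i
  refine Prod.ext ?_ ?_
  · ext r c
    simp [recover, Matrix.vecMulVec_apply, homogenize, idxC, idxW]
  · ext r
    simp [recover, Matrix.vecMulVec_apply, homogenize, idxT, idxW]

theorem rank_vecMulVec_homogenize (x : Poses Np) :
    (Matrix.vecMulVec (homogenize x) (homogenize x)).rank = 1 := by
  refine le_antisymm (Matrix.rank_vecMulVec_le _ _) (Nat.one_le_iff_ne_zero.2 fun h => ?_)
  have h1 := LinearMap.range_eq_bot.1 (Submodule.finrank_eq_zero.1 h)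
  have h2 := congrFun (LinearMap.congr_fun h1 (Pi.single idxW 1)) idxW
  simp [Matrix.vecMulVec_apply, homogenize_idxW] at h2

theorem eq_of_isStrictCertificate {m : P.Measurements} {x y : Poses Np}
    {d : (Fin Np × ((Fin 3 × Fin 3) ⊕ Fin 3) → ℝ) × ℝ}
    (h : (P.toQCQP m).IsStrictCertificate (homogenize x) d) (hx : P.IsSolution m x)
    (hy : P.IsSolution m y) : y = x := by
  have hc : P.cost m y = P.cost m x := le_antisymm (hy.2 hx.1) (hx.2 hy.1)
  have h1 := QCQP.dotProduct_dualMatrix_of_feasible d.1 d.2 (homogenize_mem_feasible hy.1 m)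
  rw [cost_homogenize, hc, ← cost_homogenize, h.cost_eq, neg_add_cancel] at h1
  obtain ⟨c, hc⟩ := h.eq_smul _ h1
  have h2 := congrFun hc idxW
  simp only [Pi.smul_apply, homogenize_idxW, smul_eq_mul, mul_one] at h2
  rw [← h2, one_smul] at hc
  rw [← posePart_homogenize y, hc, posePart_homogenize]

end PoseLocalization

end

theorem mainTheorem3 {Np Nm : ℕ} (P : PoseLocalization Np Nm)
    (hW : ∀ e, (P.weight e).PosDef)
    (hL : ∀ i : Fin Np, ¬ Coplanar ℝ (P.landmark '' {k | (i, k) ∈ P.edges})) :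
    ∃ ε : ℝ, 0 < ε ∧
      ∀ xbar ∈ PoseLocalization.feasible (Np := Np), ∀ m : P.Measurements,
        ‖m - P.noiseFree xbar‖ ^ 2 < ε →
          (P.toQCQP m).IsTight ∧
          (P.toQCQP m).StrongDuality ∧
          (∃! x, P.IsSolution m x) ∧
          (∃! Z, (P.toQCQP m).IsSDPSolution Z) ∧
          ∀ Z, (P.toQCQP m).IsSDPSolution Z →
            Z.rank = 1 ∧
            P.IsSolution m (PoseLocalization.recover Z) ∧
            (P.toQCQP m).sdpCost Z = P.cost m (PoseLocalization.recover Z) := by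
  obtain ⟨ε, hε, h⟩ := PoseLocalization.exists_isStrictCertificate hW hL
  refine ⟨ε, hε, fun xbar hxbar m hm => ?_⟩
  obtain ⟨x, hx, hcert⟩ := h xbar hxbar m hm
  refine ⟨hcert.isTight, hcert.strongDuality,
    ⟨x, hx, fun y hy => PoseLocalization.eq_of_isStrictCertificate hcert hx hy⟩,
    ⟨_, hcert.isSDPSolution_iff.2 rfl, fun Z hZ => hcert.isSDPSolution_iff.1 hZ⟩,
    fun Z hZ => ?_⟩
  obtain rfl := hcert.isSDPSolution_iff.1 hZ
  rw [PoseLocalization.recover_vecMulVec_homogenize]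
  refine ⟨PoseLocalization.rank_vecMulVec_homogenize x, hx, ?_⟩
  rw [QCQP.sdpCost, QCQP.frob_vecMulVec, ← PoseLocalization.cost_homogenize]
  rfl
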